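/- Let $\nu$ be a probability law on $\mathbb{R}$ with variance $\sigma^2>0$ whose cumulants are all finite, that is, $\mathbb{E}[e^{tX}]<\infty$ for $X\sim\nu$ and all $t$ in a neighbourhood of $0$, so that every cumulant $\kappa_m=K^{(m)}(0)$, $K(t)=\ln\mathbb{E}[e^{tX}]$, is a real number (a bound on $\kappa_m$ that is uniform in $m$ is not required). For an array $n=(n[u,v])_{0\le u<U,\,0\le v<V}$ of independent random variables of law $\nu$ let $$\mathscr{F}(n)[k,l]=\frac1{UV}\sum_{u=0}^{U-1}\sum_{v=0}^{V-1}n[u,v]\,e^{-2\pi i\left(\frac{ku}{U}+\frac{lv}{V}\right)},\qquad 0\le k<U,\ 0\le l<V,$$ and let $a(n)[k,l]$ and $b(n)[k,l]$ be its real and imaginary parts. Call these $2UV$ real random variables the Fourier coefficients of $n$. The coefficient $b(n)[k,l]$ is called degenerate if $U\mid 2k$ and $V\mid 2l$. Two coefficients are called conjugate if both are real parts or both are imaginary parts and their frequencies are equal or opposite modulo $(U,V)$. Every degenerate coefficient is identically $0$, and every other coefficient $X$ has positive variance; write $\tilde X=(X-\mathbb{E}X)/\sqrt{\operatorname{Var}X}$.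 As $UV\to\infty$ (that is, along any sequence of sizes $(U_i,V_i)$ with $U_iV_i\to\infty$, with $n_i$ an array as above of size $U_i\times V_i$, and with frequencies that may depend on $i$): (i) for every choice of a non-degenerate Fourier coefficient $X_i$ of $n_i$, $\tilde X_i$ converges in distribution to $\mathcal{N}(0,1)$; (ii) the coefficients become independent: for every fixed $d$ and every choice of $d$ non-degenerate, pairwise non-conjugate Fourier coefficients $X_{i,1},\dots,X_{i,d}$ of $n_i$, the vector $(\tilde X_{i,1},\dots,\tilde X_{i,d})$ converges in distribution to a vector of $d$ independent $\mathcal{N}(0,1)$ variables. -/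

import Mathlib

open MeasureTheory ProbabilityTheory Filter

namespace DFTNoise

/-- The normalized two-dimensional discrete Fourier transform of a real `U × V` array:
`(1 / UV) ∑ u, ∑ v, x[u,v] exp(-2πi (ku/U + lv/V))`. -/
noncomputable def dft {U V : ℕ} (x : Fin U → Fin V → ℝ) (k : Fin U) (l : Fin V) : ℂ :=
  (1 / ((U : ℂ) * (V : ℂ))) * ∑ u : Fin U, ∑ v : Fin V, (x u v : ℂ) *
    Complex.exp (-(2 * (Real.pi : ℂ) * Complex.I *
      (((k : ℕ) : ℂ) * ((u : ℕ) : ℂ) / (U : ℂ) + ((l : ℕ) : ℂ) * ((v : ℕ) : ℂ) / (V : ℂ))))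

/-- Real or imaginary part. -/
inductive Part
  | re
  | im

/-- The label of one real Fourier coefficient of a `U × V` array: the real or the imaginary part,
and the frequency `[k,l]`. -/
structure Label (U V : ℕ) where
  part : Part
  k : Fin U
  l : Fin V

namespace Label

variable {U V : ℕ}

/-- The real coefficient `a(x)[k,l]` or the imaginary coefficient `b(x)[k,l]`. -/
noncomputable def coeff (q : Label U V) (x : Fin U → Fin V → ℝ) : ℝ :=
  match q.part with
  | Part.re => (dft x q.k q.l).re
  | Part.im => (dft x q.k q.l).im

/-- The label is the imaginary part at a frequency with `[-k,-l] = [k,l]` modulo `(U,V)`. -/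
def Degenerate (q : Label U V) : Prop :=
  q.part = Part.im ∧ U ∣ 2 * (q.k : ℕ) ∧ V ∣ 2 * (q.l : ℕ)

/-- The two labels denote the same part, at frequencies that are equal or opposite modulo `(U,V)`;
for real arrays the two coefficients then agree up to sign (`F[-k,-l]` is the complex conjugate
of `F[k,l]`). -/
def Conjugate (q r : Label U V) : Prop :=
  q.part = r.part ∧
    ((q.k = r.k ∧ q.l = r.l) ∨
      (U ∣ (q.k : ℕ) + (r.k : ℕ) ∧ V ∣ (q.l : ℕ) + (r.l : ℕ)))

end Label

/-- All cumulants of the law `ν` are finite: the moment generating function is finite in a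
neighbourhood of `0`, so that the cumulant generating function `cgf id ν` is analytic there and
each cumulant, its `m`-th derivative at `0`, is a real number. The bound on the `m`-th cumulant
may depend on `m`. -/
def HasFiniteCumulants (ν : Measure ℝ) : Prop :=
  (0 : ℝ) ∈ interior (integrableExpSet id ν)

/-- `n` is noise on the `U × V` grid with independent entries of common law `ν`. -/
def IsIIDNoise {Ω : Type*} [MeasurableSpace Ω] (P : Measure Ω) (ν : Measure ℝ) {U V : ℕ}
    (n : Fin U → Fin V → Ω → ℝ) : Prop :=
  iIndepFun (fun p : Fin U × Fin V => n p.1 p.2) P ∧ ∀ u v, HasLaw (n u v) ν P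

/-- The coefficient with label `q` of the random array `n`, a random variable. -/
noncomputable def noiseCoeff {Ω : Type*} {U V : ℕ} (n : Fin U → Fin V → Ω → ℝ) (q : Label U V)
    (ω : Ω) : ℝ :=
  q.coeff (fun u v => n u v ω)

/-- `(X - E X) / σ(X)`. -/
noncomputable def standardize {Ω : Type*} [MeasurableSpace Ω] (P : Measure Ω) (X : Ω → ℝ)
    (ω : Ω) : ℝ :=
  (X ω - ∫ ω', X ω' ∂P) / Real.sqrt (variance X P)

end DFTNoise

/-! Each coefficient is a linear combination of the `UV` independent entries, with weights `cos /
UV` or `-sin / UV`. Orthogonality of characters makes the weight vectors of non-conjugate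
coefficients orthogonal (`sum_weight_mul_weight_of_not_conjugate`) and gives a non-degenerate one
squared norm at least `1 / (2UV)` (`le_sum_weight_sq`). Every weight is at most `1 / UV`, so
normalized weights are at most `√(2 / UV)`: no single entry matters in the limit. By independence
the joint characteristic function at `t` is a product of values of one characteristic function, at
small arguments whose squares sum to `|t|²`. To second order it agrees at `0` with the Gaussian one,
so the product tends to `exp (-|t|² / 2)`, and Lévy's continuity theorem concludes. -/

namespace DFTNoise

open scoped Topology

/-! ### Orthogonality of the sampled cosines and sines -/

/-- The angle `2π (ku/U + lv/V)` at the grid point `p = (u, v)`. -/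
noncomputable def phase (U V : ℕ) (k l : ℤ) (p : Fin U × Fin V) : ℝ :=
  2 * Real.pi * (k * (p.1 : ℕ) / U + l * (p.2 : ℕ) / V)

lemma phase_add (U V : ℕ) (k l k' l' : ℤ) (p : Fin U × Fin V) :
    phase U V (k + k') (l + l') p = phase U V k l p + phase U V k' l' p := by
  simp only [phase, Int.cast_add]; ring

lemma phase_sub (U V : ℕ) (k l k' l' : ℤ) (p : Fin U × Fin V) :
    phase U V (k - k') (l - l') p = phase U V k l p - phase U V k' l' p := by
  simp only [phase, Int.cast_sub]; ring

/-- A geometric sum whose ratio is an `N`-th root of unity, equal to `1` exactly when `N ∣ k`. -/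
lemma sum_exp_two_pi_mul_div {N : ℕ} (hN : N ≠ 0) (k : ℤ) :
    ∑ u : Fin N, Complex.exp (2 * Real.pi * Complex.I * (k * (u : ℕ) / N)) =
      if (N : ℤ) ∣ k then (N : ℂ) else 0 := by
  have hζ := Complex.isPrimitiveRoot_exp N hN
  set ζ := Complex.exp (2 * Real.pi * Complex.I / N) with hζdef
  have hterm (u : ℕ) :
      Complex.exp (2 * Real.pi * Complex.I * (k * (u : ℕ) / N)) = (ζ ^ k) ^ u := by
    rw [hζdef, ← Complex.exp_int_mul, ← Complex.exp_nat_mul]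
    congr 1; ring
  simp_rw [hterm]
  rw [Fin.sum_univ_eq_sum_range (fun u => (ζ ^ k) ^ u)]
  split_ifs with hk
  · simp [(hζ.zpow_eq_one_iff_dvd k).2 hk]
  · have hne : ζ ^ k ≠ 1 := fun h => hk ((hζ.zpow_eq_one_iff_dvd k).1 h)
    have hpow : (ζ ^ k) ^ N = 1 := by
      rw [← zpow_natCast, ← zpow_mul, mul_comm, zpow_mul, zpow_natCast, hζ.pow_eq_one, one_zpow]
    rw [geom_sum_eq hne, hpow, sub_self, zero_div]

lemma sum_exp_phase {U V : ℕ} (hU : U ≠ 0) (hV : V ≠ 0) (k l : ℤ) :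
    ∑ p, Complex.exp (phase U V k l p * Complex.I) =
      ((if (U : ℤ) ∣ k ∧ (V : ℤ) ∣ l then (U * V : ℝ) else 0 : ℝ) : ℂ) := by
  have h : ∑ p, Complex.exp (phase U V k l p * Complex.I) =
      (∑ u : Fin U, Complex.exp (2 * Real.pi * Complex.I * (k * (u : ℕ) / U))) *
        ∑ v : Fin V, Complex.exp (2 * Real.pi * Complex.I * (l * (v : ℕ) / V)) := by
    rw [Fintype.sum_prod_type, Finset.sum_mul_sum]
    refine Finset.sum_congr rfl fun u _ => Finset.sum_congr rfl fun v _ => ?_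
    rw [← Complex.exp_add]
    congr 1
    simp only [phase]; push_cast; ring
  rw [h, sum_exp_two_pi_mul_div hU, sum_exp_two_pi_mul_div hV]
  split_ifs <;> simp_all

lemma sum_cos_phase {U V : ℕ} (hU : U ≠ 0) (hV : V ≠ 0) (k l : ℤ) :
    ∑ p, Real.cos (phase U V k l p) = if (U : ℤ) ∣ k ∧ (V : ℤ) ∣ l then (U * V : ℝ) else 0 := by
  have h := congrArg Complex.re (sum_exp_phase hU hV k l)
  rwa [Complex.re_sum, Complex.ofReal_re,
    Finset.sum_congr rfl fun p _ => Complex.exp_ofReal_mul_I_re _] at h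

lemma sum_sin_phase {U V : ℕ} (hU : U ≠ 0) (hV : V ≠ 0) (k l : ℤ) :
    ∑ p, Real.sin (phase U V k l p) = 0 := by
  have h := congrArg Complex.im (sum_exp_phase hU hV k l)
  rwa [Complex.im_sum, Complex.ofReal_im,
    Finset.sum_congr rfl fun p _ => Complex.exp_ofReal_mul_I_im _] at h

/-! ### The coefficients as weighted sums -/

namespace Label

variable {U V : ℕ}

/-- The weight, up to the factor `1 / UV`, of the entry at `p` in the coefficient labelled `q`. -/
noncomputable def weight (q : Label U V) (p : Fin U × Fin V) : ℝ :=
  match q.part with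
  | Part.re => Real.cos (phase U V (q.k : ℕ) (q.l : ℕ) p)
  | Part.im => -Real.sin (phase U V (q.k : ℕ) (q.l : ℕ) p)

lemma abs_weight_le_one (q : Label U V) (p : Fin U × Fin V) : |q.weight p| ≤ 1 := by
  rcases q with ⟨_ | _, k, l⟩
  · exact Real.abs_cos_le_one _
  · simpa [weight] using Real.abs_sin_le_one _

lemma coeff_eq_sum (q : Label U V) (x : Fin U → Fin V → ℝ) :
    q.coeff x = ∑ p : Fin U × Fin V, q.weight p / (U * V) * x p.1 p.2 := by
  have h : dft x q.k q.l = ∑ p : Fin U × Fin V, ((x p.1 p.2 / (U * V) : ℝ) : ℂ) *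
      Complex.exp (((-phase U V (q.k : ℕ) (q.l : ℕ) p : ℝ) : ℂ) * Complex.I) := by
    rw [dft, Fintype.sum_prod_type, Finset.mul_sum]
    refine Finset.sum_congr rfl fun u _ => ?_
    rw [Finset.mul_sum]
    refine Finset.sum_congr rfl fun v _ => ?_
    rw [← mul_assoc]
    congr 1
    · push_cast; ring
    · congr 1
      simp only [phase]; push_cast; ring
  rcases q with ⟨_ | _, k, l⟩
  · simp only [coeff, weight, h, Complex.re_sum]
    refine Finset.sum_congr rfl fun p _ => ?_
    rw [Complex.re_ofReal_mul, Complex.exp_ofReal_mul_I_re, Real.cos_neg]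
    ring
  · simp only [coeff, weight, h, Complex.im_sum]
    refine Finset.sum_congr rfl fun p _ => ?_
    rw [Complex.im_ofReal_mul, Complex.exp_ofReal_mul_I_im, Real.sin_neg]
    ring

lemma ne_zero_of_label (q : Label U V) : U ≠ 0 ∧ V ≠ 0 :=
  ⟨(Fin.pos q.k).ne', (Fin.pos q.l).ne'⟩

lemma cast_dvd_sub_iff {N : ℕ} (a b : Fin N) : (N : ℤ) ∣ ((a : ℕ) : ℤ) - ((b : ℕ) : ℤ) ↔ a = b := by
  constructor
  · intro h
    have := Int.eq_zero_of_abs_lt_dvd h (by have := a.2; have := b.2; rw [abs_lt]; omega)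
    ext; omega
  · rintro rfl; simp

lemma cast_dvd_add_iff (N a b : ℕ) : (N : ℤ) ∣ (a : ℤ) + (b : ℤ) ↔ N ∣ a + b := by
  exact_mod_cast Int.natCast_dvd_natCast (m := N) (n := a + b)

/-- Product-to-sum formulas reduce to frequencies `q - r` and `q + r`. For equal parts,
non-conjugacy says that neither vanishes modulo `(U, V)`, so both cosine sums are zero. For mixed
parts only sines appear, and these sum to zero at every frequency. -/
lemma sum_weight_mul_weight_of_not_conjugate {q r : Label U V} (h : ¬ q.Conjugate r) :
    ∑ p, q.weight p * r.weight p = 0 := by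
  obtain ⟨hU, hV⟩ := q.ne_zero_of_label
  rcases q with ⟨_ | _, k, l⟩ <;> rcases r with ⟨_ | _, k', l'⟩
  all_goals simp only [Conjugate, true_and, not_or, reduceCtorEq, false_and, not_false_eq_true] at h
  all_goals simp only [weight]
  · have e (p : Fin U × Fin V) : Real.cos (phase U V (k : ℕ) (l : ℕ) p) *
        Real.cos (phase U V (k' : ℕ) (l' : ℕ) p) =
        (Real.cos (phase U V ((k : ℕ) - (k' : ℕ)) ((l : ℕ) - (l' : ℕ)) p) +
          Real.cos (phase U V ((k : ℕ) + (k' : ℕ)) ((l : ℕ) + (l' : ℕ)) p)) / 2 := by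
      rw [phase_sub, phase_add, Real.cos_sub, Real.cos_add]; ring
    rw [Finset.sum_congr rfl fun p _ => e p, ← Finset.sum_div, Finset.sum_add_distrib,
      sum_cos_phase hU hV, sum_cos_phase hU hV]
    simp only [cast_dvd_sub_iff, cast_dvd_add_iff, if_neg h.1, if_neg h.2]
    simp
  · have e (p : Fin U × Fin V) : Real.cos (phase U V (k : ℕ) (l : ℕ) p) *
        -Real.sin (phase U V (k' : ℕ) (l' : ℕ) p) =
        (Real.sin (phase U V ((k : ℕ) - (k' : ℕ)) ((l : ℕ) - (l' : ℕ)) p) -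
          Real.sin (phase U V ((k : ℕ) + (k' : ℕ)) ((l : ℕ) + (l' : ℕ)) p)) / 2 := by
      rw [phase_sub, phase_add, Real.sin_sub, Real.sin_add]; ring
    rw [Finset.sum_congr rfl fun p _ => e p, ← Finset.sum_div, Finset.sum_sub_distrib,
      sum_sin_phase hU hV, sum_sin_phase hU hV]
    simp
  · have e (p : Fin U × Fin V) : -Real.sin (phase U V (k : ℕ) (l : ℕ) p) *
        Real.cos (phase U V (k' : ℕ) (l' : ℕ) p) =
        -(Real.sin (phase U V ((k : ℕ) - (k' : ℕ)) ((l : ℕ) - (l' : ℕ)) p) +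
          Real.sin (phase U V ((k : ℕ) + (k' : ℕ)) ((l : ℕ) + (l' : ℕ)) p)) / 2 := by
      rw [phase_sub, phase_add, Real.sin_sub, Real.sin_add]; ring
    rw [Finset.sum_congr rfl fun p _ => e p, ← Finset.sum_div, Finset.sum_neg_distrib,
      Finset.sum_add_distrib, sum_sin_phase hU hV, sum_sin_phase hU hV]
    simp
  · have e (p : Fin U × Fin V) : -Real.sin (phase U V (k : ℕ) (l : ℕ) p) *
        -Real.sin (phase U V (k' : ℕ) (l' : ℕ) p) =
        (Real.cos (phase U V ((k : ℕ) - (k' : ℕ)) ((l : ℕ) - (l' : ℕ)) p) -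
          Real.cos (phase U V ((k : ℕ) + (k' : ℕ)) ((l : ℕ) + (l' : ℕ)) p)) / 2 := by
      rw [phase_sub, phase_add, Real.cos_sub, Real.cos_add]; ring
    rw [Finset.sum_congr rfl fun p _ => e p, ← Finset.sum_div, Finset.sum_sub_distrib,
      sum_cos_phase hU hV, sum_cos_phase hU hV]
    simp only [cast_dvd_sub_iff, cast_dvd_add_iff, if_neg h.1, if_neg h.2]
    simp

/-- By the double-angle formula the sum is `UV / 2` plus (real part) or minus (imaginary part) half
the cosine sum at the doubled frequency. That sum is nonnegative, and non-degeneracy makes it zero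
for an imaginary part. -/
lemma le_sum_weight_sq {q : Label U V} (h : ¬ q.Degenerate) :
    (U * V : ℝ) / 2 ≤ ∑ p, q.weight p ^ 2 := by
  obtain ⟨hU, hV⟩ := q.ne_zero_of_label
  have hsum := sum_cos_phase hU hV (2 * (q.k : ℕ)) (2 * (q.l : ℕ))
  have hphase (p : Fin U × Fin V) : phase U V (2 * (q.k : ℕ)) (2 * (q.l : ℕ)) p =
      2 * phase U V (q.k : ℕ) (q.l : ℕ) p := by
    rw [two_mul, two_mul, phase_add, two_mul]
  simp_rw [hphase, Real.cos_two_mul] at hsum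
  rw [Finset.sum_sub_distrib, ← Finset.mul_sum] at hsum
  simp only [Finset.sum_const, Finset.card_univ, Fintype.card_prod, Fintype.card_fin, nsmul_eq_mul,
    mul_one, Nat.cast_mul] at hsum
  have hpos : (0 : ℝ) ≤ U * V := by positivity
  rcases q with ⟨_ | _, k, l⟩
  · simp only [weight]
    split_ifs at hsum <;> linarith
  · have hn : ¬ ((U : ℤ) ∣ 2 * ((k : ℕ) : ℤ) ∧ (V : ℤ) ∣ 2 * ((l : ℕ) : ℤ)) := by
      simp only [Degenerate, true_and] at h
      exact_mod_cast h
    rw [if_neg hn] at hsum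
    simp only [weight, neg_sq, Real.sin_sq, Finset.sum_sub_distrib]
    simp only [Finset.sum_const, Finset.card_univ, Fintype.card_prod, Fintype.card_fin,
      nsmul_eq_mul, mul_one, Nat.cast_mul]
    linarith

lemma weight_eq_zero_of_degenerate {q : Label U V} (h : q.Degenerate) (p : Fin U × Fin V) :
    q.weight p = 0 := by
  obtain ⟨hU, hV⟩ := q.ne_zero_of_label
  rcases q with ⟨_ | _, k, l⟩
  · exact absurd h.1 (by simp)
  · obtain ⟨-, ⟨a, ha⟩, b, hb⟩ := h
    simp only [weight, neg_eq_zero, Real.sin_eq_zero_iff]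
    -- With `2k = Ua` and `2l = Vb` the phase at `(u, v)` is `π (au + bv)`.
    refine ⟨a * (p.1 : ℕ) + b * (p.2 : ℕ), ?_⟩
    have ha' : 2 * ((k : ℕ) : ℝ) = U * a := by exact_mod_cast ha
    have hb' : 2 * ((l : ℕ) : ℝ) = V * b := by exact_mod_cast hb
    have hU' : (U : ℝ) ≠ 0 := by exact_mod_cast hU
    have hV' : (V : ℝ) ≠ 0 := by exact_mod_cast hV
    simp only [phase]
    push_cast
    have e : 2 * Real.pi * ((k : ℕ) * (p.1 : ℕ) / U + (l : ℕ) * (p.2 : ℕ) / V) =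
      Real.pi * ((2 * ((k : ℕ) : ℝ)) * (p.1 : ℕ) / U + (2 * ((l : ℕ) : ℝ)) * (p.2 : ℕ) / V) := by
      ring
    rw [e, ha', hb']
    field_simp

end Label

/-! ### A central limit theorem for weighted sums -/

/-- Exchange the factors one at a time; all remaining factors have norm at most `1`. -/
lemma norm_prod_sub_prod_le {ι : Type*} (s : Finset ι) (f g : ι → ℂ) (hf : ∀ p, ‖f p‖ ≤ 1)
    (hg : ∀ p, ‖g p‖ ≤ 1) : ‖∏ p ∈ s, f p - ∏ p ∈ s, g p‖ ≤ ∑ p ∈ s, ‖f p - g p‖ := by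
  classical
  induction s using Finset.induction_on with
  | empty => simp
  | insert a s ha ih =>
    rw [Finset.prod_insert ha, Finset.prod_insert ha, Finset.sum_insert ha]
    have hprod : ‖∏ p ∈ s, f p‖ ≤ 1 := by
      rw [norm_prod]
      exact Finset.prod_le_one (fun _ _ => norm_nonneg _) fun p _ => hf p
    calc ‖f a * ∏ p ∈ s, f p - g a * ∏ p ∈ s, g p‖
        = ‖(f a - g a) * ∏ p ∈ s, f p + g a * (∏ p ∈ s, f p - ∏ p ∈ s, g p)‖ := by ring_nf
      _ ≤ ‖f a - g a‖ * ‖∏ p ∈ s, f p‖ + ‖g a‖ * ‖∏ p ∈ s, f p - ∏ p ∈ s, g p‖ := by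
        refine (norm_add_le _ _).trans_eq ?_
        rw [norm_mul, norm_mul]
      _ ≤ ‖f a - g a‖ * 1 + 1 * ∑ p ∈ s, ‖f p - g p‖ := by
        gcongr
        exact hg a
      _ = _ := by ring

/-- The characteristic functions of two centred laws of variance `1` agree to second order
at `0`. -/
lemma charFun_sub_charFun_isLittleO {μ μ' : Measure ℝ} [IsProbabilityMeasure μ]
    [IsProbabilityMeasure μ'] (h0 : ∫ x, x ∂μ = 0) (h1 : ∫ x, x ^ 2 ∂μ = 1)
    (h0' : ∫ x, x ∂μ' = 0) (h1' : ∫ x, x ^ 2 ∂μ' = 1) :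
    (fun t => charFun μ t - charFun μ' t) =o[𝓝 0] fun t : ℝ => t ^ 2 := by
  have h := taylor_charFun_two (P := μ) (X := id) aemeasurable_id h0 h1
  have h' := taylor_charFun_two (P := μ') (X := id) aemeasurable_id h0' h1'
  simp only [Measure.map_id] at h h'
  simpa using h.sub h'

lemma integral_sq_gaussianReal_zero_one : ∫ x, x ^ 2 ∂(gaussianReal 0 1) = 1 := by
  have h := variance_id_gaussianReal (μ := 0) (v := 1)
  rw [variance_eq_integral aemeasurable_id] at h
  simpa using h

/-- The same product for the standard Gaussian equals the limit exactly for every `i`, so only a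
factor-by-factor comparison remains. -/
lemma tendsto_prod_charFun {μ : Measure ℝ} [IsProbabilityMeasure μ]
    (h0 : ∫ x, x ∂μ = 0) (h1 : ∫ x, x ^ 2 ∂μ = 1) {ι : ℕ → Type*} [∀ i, Fintype (ι i)]
    (a : ∀ i, ι i → ℝ) (s : ℝ) (hs : ∀ i, ∑ p, a i p ^ 2 = s) (ε : ℕ → ℝ)
    (hε : Tendsto ε atTop (𝓝 0)) (ha : ∀ i p, |a i p| ≤ ε i) :
    Tendsto (fun i => ∏ p, charFun μ (a i p)) atTop (𝓝 (Complex.exp (-(s : ℂ) / 2))) := by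
  have hs0 : 0 ≤ s := hs 0 ▸ Finset.sum_nonneg fun _ _ => sq_nonneg _
  have hgauss (i : ℕ) :
      ∏ p, charFun (gaussianReal 0 1) (a i p) = Complex.exp (-(s : ℂ) / 2) := by
    simp only [charFun_gaussianReal]
    rw [← Complex.exp_sum, ← hs i]
    congr 1
    push_cast
    rw [← Finset.sum_neg_distrib, Finset.sum_div]
    refine Finset.sum_congr rfl fun p _ => ?_
    ring
  rw [tendsto_iff_norm_sub_tendsto_zero, Metric.tendsto_atTop']
  intro δ hδ
  -- The factor errors then add up to at most `δ s / (s + 1)`, which is below `δ` even when `s = 0`.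
  have hlo := (charFun_sub_charFun_isLittleO h0 h1 integral_id_gaussianReal
    integral_sq_gaussianReal_zero_one).def (c := δ / (s + 1)) (by positivity)
  obtain ⟨r, hr, hball⟩ := Metric.eventually_nhds_iff.1 hlo
  obtain ⟨N, hN⟩ := eventually_atTop.1 (hε.eventually (gt_mem_nhds hr))
  refine ⟨N, fun i hi => ?_⟩
  rw [Real.dist_0_eq_abs, abs_norm, ← hgauss i]
  calc ‖∏ p, charFun μ (a i p) - ∏ p, charFun (gaussianReal 0 1) (a i p)‖
      ≤ ∑ p, ‖charFun μ (a i p) - charFun (gaussianReal 0 1) (a i p)‖ :=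
        norm_prod_sub_prod_le _ _ _ (fun _ => norm_charFun_le_one _)
          fun _ => norm_charFun_le_one _
    _ ≤ ∑ p, δ / (s + 1) * a i p ^ 2 := by
        refine Finset.sum_le_sum fun p _ => ?_
        have := hball (y := a i p) (by
          rw [Real.dist_0_eq_abs]; exact (ha i p).trans_lt (hN i hi.le))
        simpa using this
    _ = δ * (s / (s + 1)) := by rw [← Finset.mul_sum, hs]; ring
    _ < δ := by
        have : s / (s + 1) < 1 := by rw [div_lt_one (by positivity)]; linarith
        nlinarith

/-- The Cramér–Wold reduction: pairing the vector with `t` gives one weighted sum of the independent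
`Y p`, whose characteristic function factors. -/
lemma charFun_map_weighted_sum {Ω ι : Type*} [MeasurableSpace Ω] [Fintype ι] {P : Measure Ω}
    {μ : Measure ℝ} {Y : ι → Ω → ℝ} (hY : iIndepFun Y P) (hlaw : ∀ p, HasLaw (Y p) μ P) {d : ℕ}
    (w : Fin d → ι → ℝ) (t : EuclideanSpace ℝ (Fin d)) :
    charFun (P.map fun ω => WithLp.toLp 2 fun j => ∑ p, w j p * Y p ω) t =
      ∏ p, charFun μ (∑ j, t j * w j p) := by
  have hm p : AEMeasurable (Y p) P := (hlaw p).aemeasurable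
  have hmeas : AEMeasurable
      (fun ω => (WithLp.toLp 2 fun j => ∑ p, w j p * Y p ω : EuclideanSpace ℝ (Fin d))) P :=
    (WithLp.measurable_toLp 2 _).comp_aemeasurable (aemeasurable_pi_lambda _ fun j =>
      Finset.aemeasurable_fun_sum _ fun p _ => (hm p).const_mul _)
  have hscal : charFun (P.map fun ω => WithLp.toLp 2 fun j => ∑ p, w j p * Y p ω) t =
      charFun (P.map fun ω => ∑ p, (∑ j, t j * w j p) * Y p ω) 1 := by
    rw [charFun_apply, charFun_apply_real, integral_map hmeas (by fun_prop),
      integral_map (Finset.aemeasurable_fun_sum _ fun p _ => (hm p).const_mul _) (by fun_prop)]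
    refine integral_congr_ae (ae_of_all _ fun ω => ?_)
    simp only [PiLp.inner_apply, RCLike.inner_apply, conj_trivial, Finset.mul_sum, Finset.sum_mul,
      Complex.ofReal_one, one_mul]
    rw [Finset.sum_comm]
    simp only [mul_assoc]
  have hindep : iIndepFun (fun p ω => (∑ j, t j * w j p) * Y p ω) P :=
    hY.comp (fun p x => (∑ j, t j * w j p) * x) fun p => by fun_prop
  rw [hscal, hindep.charFun_map_fun_sum_eq_prod fun p => (hm p).const_mul _, Finset.prod_apply]
  refine Finset.prod_congr rfl fun p _ => ?_
  rw [charFun_map_mul_comp (hm p), (hlaw p).map_eq, mul_one]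

/-- Orthonormal families of uniformly small weights: the weighted sums of independent variables of a
common centred law of variance `1` converge jointly to independent standard Gaussians. -/
theorem tendstoInDistribution_weighted_sum {μ : Measure ℝ} [IsProbabilityMeasure μ]
    (h0 : ∫ x, x ∂μ = 0) (h1 : ∫ x, x ^ 2 ∂μ = 1) {ι : ℕ → Type*} [∀ i, Fintype (ι i)]
    {Ω : ℕ → Type*} [∀ i, MeasurableSpace (Ω i)] (P : ∀ i, Measure (Ω i))
    [∀ i, IsProbabilityMeasure (P i)] (Y : ∀ i, ι i → Ω i → ℝ) (hY : ∀ i, iIndepFun (Y i) (P i))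
    (hlaw : ∀ i p, HasLaw (Y i p) μ (P i)) {d : ℕ} (w : ∀ i, Fin d → ι i → ℝ)
    (hw : ∀ i j j', ∑ p, w i j p * w i j' p = if j = j' then 1 else 0) (ε : ℕ → ℝ)
    (hε : Tendsto ε atTop (𝓝 0)) (hsmall : ∀ i j p, |w i j p| ≤ ε i) :
    TendstoInDistribution (fun i ω j => ∑ p, w i j p * Y i p ω) atTop
      (id : (Fin d → ℝ) → (Fin d → ℝ)) P (Measure.pi fun _ : Fin d => gaussianReal 0 1) := by
  have hmeas i : AEMeasurable (fun ω j => ∑ p, w i j p * Y i p ω) (P i) :=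
    aemeasurable_pi_lambda _ fun j => Finset.aemeasurable_fun_sum _ fun p _ =>
      (hlaw i p).aemeasurable.const_mul _
  have htoLp : Measurable (WithLp.toLp 2 : (Fin d → ℝ) → EuclideanSpace ℝ (Fin d)) :=
    WithLp.measurable_toLp 2 _
  -- Characteristic functions need an inner product, so convergence is proved in `EuclideanSpace`
  -- and carried back by a continuous map.
  have key : TendstoInDistribution
      (fun i ω => (WithLp.toLp 2 fun j => ∑ p, w i j p * Y i p ω : EuclideanSpace ℝ (Fin d))) atTop
      (WithLp.toLp 2 : (Fin d → ℝ) → EuclideanSpace ℝ (Fin d)) P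
      (Measure.pi fun _ : Fin d => gaussianReal 0 1) := by
    refine ⟨fun i => htoLp.comp_aemeasurable (hmeas i), htoLp.aemeasurable, ?_⟩
    refine ProbabilityMeasure.tendsto_iff_tendsto_charFun.2 fun t => ?_
    simp only [ProbabilityMeasure.coe_mk]
    simp_rw [charFun_map_weighted_sum (hY _) (hlaw _)]
    rw [charFun_pi]
    have hlim : ∏ j, charFun (gaussianReal 0 1) (t j) =
        Complex.exp (-((∑ j, t j ^ 2 : ℝ) : ℂ) / 2) := by
      simp only [charFun_gaussianReal]
      rw [← Complex.exp_sum]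
      congr 1
      push_cast
      rw [← Finset.sum_neg_distrib, Finset.sum_div]
      refine Finset.sum_congr rfl fun p _ => ?_
      ring
    rw [hlim]
    refine tendsto_prod_charFun h0 h1 (fun i p => ∑ j, t j * w i j p) _ (fun i => ?_)
      (fun i => (∑ j, |t j|) * ε i) (by simpa using hε.const_mul (∑ j, |t j|)) fun i p => ?_
    -- Orthonormality removes the cross terms and leaves `|t|²`, independent of `i`.
    · calc ∑ p, (∑ j, t j * w i j p) ^ 2
          = ∑ p, ∑ j, ∑ j', t j * t j' * (w i j p * w i j' p) := by
            refine Finset.sum_congr rfl fun p _ => ?_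
            rw [sq, Finset.sum_mul_sum]
            refine Finset.sum_congr rfl fun j _ => Finset.sum_congr rfl fun j' _ => ?_
            ring
        _ = ∑ j, ∑ j', t j * t j' * ∑ p, w i j p * w i j' p := by
            rw [Finset.sum_comm]
            refine Finset.sum_congr rfl fun j _ => ?_
            rw [Finset.sum_comm]
            simp only [Finset.mul_sum]
        _ = ∑ j, t j ^ 2 := by
            simp [hw, sq]
    · rw [Finset.sum_mul]
      refine (Finset.abs_sum_le_sum_abs _ _).trans (Finset.sum_le_sum fun j _ => ?_)
      rw [abs_mul]
      exact mul_le_mul_of_nonneg_left (hsmall i j p) (abs_nonneg _)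
  exact key.continuous_comp (PiLp.continuous_ofLp 2 fun _ : Fin d => ℝ)

/-! ### Standardized weighted sums -/

section Standardize

variable {Ω ι : Type*} [MeasurableSpace Ω] [Fintype ι] {P : Measure Ω}
  {ν : Measure ℝ} {Y : ι → Ω → ℝ}

lemma integral_weighted_sum (hν : Integrable id ν) (hlaw : ∀ p, HasLaw (Y p) ν P) (c : ι → ℝ) :
    ∫ ω, ∑ p, c p * Y p ω ∂P = (∑ p, c p) * ∫ x, x ∂ν := by
  have hint p : Integrable (Y p) P := by
    have := (hlaw p).map_eq ▸ hν
    exact this.comp_aemeasurable (hlaw p).aemeasurable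
  rw [integral_finsetSum _ fun p _ => (hint p).const_mul _, Finset.sum_mul]
  refine Finset.sum_congr rfl fun p _ => ?_
  rw [integral_const_mul, (hlaw p).integral_eq]

lemma variance_weighted_sum (hν : MemLp id 2 ν) (hY : iIndepFun Y P)
    (hlaw : ∀ p, HasLaw (Y p) ν P) (c : ι → ℝ) :
    variance (fun ω => ∑ p, c p * Y p ω) P = (∑ p, c p ^ 2) * variance id ν := by
  have hLp p : MemLp (fun ω => c p * Y p ω) 2 P := by
    have := (hlaw p).map_eq ▸ hν
    exact (this.comp_of_map (hlaw p).aemeasurable).const_mul _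
  have hindep : iIndepFun (fun p ω => c p * Y p ω) P :=
    hY.comp (fun p x => c p * x) fun p => by fun_prop
  have h := IndepFun.variance_sum (s := Finset.univ) (fun p _ => hLp p)
    fun p _ p' _ hpp => hindep.indepFun hpp
  rw [Finset.sum_fn] at h
  rw [h, Finset.sum_mul]
  refine Finset.sum_congr rfl fun p _ => ?_
  rw [variance_const_mul, (hlaw p).variance_eq]

/-- Centring and scaling pass to the entries, leaving normalized weights on standardized entries,
the form required by `tendstoInDistribution_weighted_sum`. -/
lemma standardize_weighted_sum (hν : MemLp id 2 ν) [IsProbabilityMeasure ν] (hY : iIndepFun Y P)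
    (hlaw : ∀ p, HasLaw (Y p) ν P) (c : ι → ℝ) (ω : Ω) :
    standardize P (fun ω => ∑ p, c p * Y p ω) ω =
      ∑ p, c p / √(∑ p, c p ^ 2) * ((Y p ω - ∫ x, x ∂ν) / √(variance id ν)) := by
  rw [standardize, integral_weighted_sum (hν.integrable (by norm_num)) hlaw,
    variance_weighted_sum hν hY hlaw, Real.sqrt_mul (Finset.sum_nonneg fun _ _ => sq_nonneg _),
    Finset.sum_mul, ← Finset.sum_sub_distrib, Finset.sum_div]
  refine Finset.sum_congr rfl fun p _ => ?_
  rw [div_mul_div_comm, mul_sub]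

end Standardize

section Normalize

variable {ν : Measure ℝ}

lemma integral_normalize [IsProbabilityMeasure ν] (hν : Integrable id ν) :
    ∫ x, x ∂(ν.map fun x => (x - ∫ y, y ∂ν) / √(variance id ν)) = 0 := by
  have hν' : Integrable (fun x => x) ν := hν
  rw [integral_map (by fun_prop) (by fun_prop), integral_div, integral_sub hν' (by fun_prop)]
  simp

lemma integral_sq_normalize (hσ : 0 < variance id ν) :
    ∫ x, x ^ 2 ∂(ν.map fun x => (x - ∫ y, y ∂ν) / √(variance id ν)) = 1 := by
  rw [integral_map (by fun_prop) (by fun_prop)]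
  simp only [div_pow, Real.sq_sqrt hσ.le]
  rw [integral_div, div_eq_one_iff_eq hσ.ne', variance_eq_integral aemeasurable_id]
  rfl

end Normalize

/-! ### The noise coefficients -/

namespace Label

variable {U V : ℕ}

/-- The weights of the coefficient labelled `q`. -/
noncomputable def scaledWeight (q : Label U V) (p : Fin U × Fin V) : ℝ := q.weight p / (U * V)

lemma cast_mul_cast_pos (q : Label U V) : (0 : ℝ) < U * V := by
  obtain ⟨hU, hV⟩ := q.ne_zero_of_label
  positivity

lemma le_sum_scaledWeight_sq {q : Label U V} (h : ¬ q.Degenerate) :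
    1 / (2 * (U * V : ℝ)) ≤ ∑ p, q.scaledWeight p ^ 2 := by
  have hpos := q.cast_mul_cast_pos
  simp only [scaledWeight, div_pow, ← Finset.sum_div]
  rw [le_div_iff₀ (by positivity)]
  refine le_trans (le_of_eq ?_) (le_sum_weight_sq h)
  field_simp

lemma sum_scaledWeight_sq_pos {q : Label U V} (h : ¬ q.Degenerate) :
    0 < ∑ p, q.scaledWeight p ^ 2 := by
  have hpos := q.cast_mul_cast_pos
  exact lt_of_lt_of_le (by positivity) (le_sum_scaledWeight_sq h)

lemma sum_scaledWeight_mul_scaledWeight {q r : Label U V} (h : ¬ q.Conjugate r) :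
    ∑ p, q.scaledWeight p * r.scaledWeight p = 0 := by
  simp only [scaledWeight, div_mul_div_comm, ← Finset.sum_div,
    sum_weight_mul_weight_of_not_conjugate h, zero_div]

/-- The bound depends on the product `UV` alone, so the frequencies may vary freely and one side of
the grid may stay bounded. -/
lemma abs_scaledWeight_div_le {q : Label U V} (h : ¬ q.Degenerate) (p : Fin U × Fin V) :
    |q.scaledWeight p / √(∑ p, q.scaledWeight p ^ 2)| ≤ √(2 / (U * V : ℝ)) := by
  have hpos := q.cast_mul_cast_pos
  have hS := sum_scaledWeight_sq_pos h
  apply Real.abs_le_sqrt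
  rw [div_pow, Real.sq_sqrt hS.le, div_le_iff₀ hS]
  have hw : q.weight p ^ 2 ≤ 1 := (sq_le_one_iff_abs_le_one _).2 (q.abs_weight_le_one p)
  calc q.scaledWeight p ^ 2 = q.weight p ^ 2 / (U * V : ℝ) ^ 2 := by rw [scaledWeight, div_pow]
    _ ≤ 1 / (U * V : ℝ) ^ 2 := by gcongr
    _ = 2 / (U * V : ℝ) * (1 / (2 * (U * V : ℝ))) := by field_simp
    _ ≤ _ := by
      gcongr
      exact le_sum_scaledWeight_sq h

end Label

lemma noiseCoeff_eq_sum {Ω : Type*} {U V : ℕ} (n : Fin U → Fin V → Ω → ℝ) (q : Label U V) :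
    noiseCoeff n q = fun ω => ∑ p : Fin U × Fin V, q.scaledWeight p * n p.1 p.2 ω :=
  funext fun _ => q.coeff_eq_sum _

lemma noiseCoeff_eq_zero {Ω : Type*} {U V : ℕ} (n : Fin U → Fin V → Ω → ℝ) {q : Label U V}
    (h : q.Degenerate) (ω : Ω) : noiseCoeff n q ω = 0 := by
  simp [noiseCoeff_eq_sum, Label.scaledWeight, Label.weight_eq_zero_of_degenerate h]

lemma HasFiniteCumulants.memLp_two {ν : Measure ℝ} (hν : HasFiniteCumulants ν) : MemLp id 2 ν := by
  simpa using memLp_of_mem_interior_integrableExpSet hν 2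

lemma variance_noiseCoeff_pos {Ω : Type*} [MeasurableSpace Ω] {P : Measure Ω}
    [IsProbabilityMeasure P] {ν : Measure ℝ} (hν : MemLp id 2 ν) (hσ : 0 < variance id ν) {U V : ℕ}
    {n : Fin U → Fin V → Ω → ℝ} (hn : IsIIDNoise P ν n) {q : Label U V} (h : ¬ q.Degenerate) :
    0 < variance (noiseCoeff n q) P := by
  rw [noiseCoeff_eq_sum, variance_weighted_sum hν hn.1 fun p => hn.2 p.1 p.2]
  exact mul_pos (Label.sum_scaledWeight_sq_pos h) hσ

theorem tendstoInDistribution_standardize_noiseCoeff {ν : Measure ℝ} [IsProbabilityMeasure ν]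
    (hν : MemLp id 2 ν) (hσ : 0 < variance id ν) {U V : ℕ → ℕ}
    (hUV : Tendsto (fun i => U i * V i) atTop atTop) {Ω : ℕ → Type*} [∀ i, MeasurableSpace (Ω i)]
    {P : ∀ i, Measure (Ω i)} [∀ i, IsProbabilityMeasure (P i)]
    {n : ∀ i, Fin (U i) → Fin (V i) → Ω i → ℝ} (hn : ∀ i, IsIIDNoise (P i) ν (n i)) {d : ℕ}
    (q : ∀ i, Fin d → Label (U i) (V i)) (hq : ∀ i j, ¬ (q i j).Degenerate)
    (hconj : ∀ i j j', j ≠ j' → ¬ (q i j).Conjugate (q i j')) :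
    TendstoInDistribution (fun i ω j => standardize (P i) (noiseCoeff (n i) (q i j)) ω) atTop
      (id : (Fin d → ℝ) → (Fin d → ℝ)) P (Measure.pi fun _ : Fin d => gaussianReal 0 1) := by
  set g : ℝ → ℝ := fun x => (x - ∫ y, y ∂ν) / √(variance id ν)
  have hgm : Measurable g := by fun_prop
  have : IsProbabilityMeasure (ν.map g) := Measure.isProbabilityMeasure_map hgm.aemeasurable
  have hε : Tendsto (fun i => √(2 / ((U i : ℝ) * V i))) atTop (𝓝 0) := by
    have h : Tendsto (fun i => ((U i * V i : ℕ) : ℝ)) atTop atTop :=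
      tendsto_natCast_atTop_atTop.comp hUV
    push_cast at h
    simpa using (h.const_div_atTop 2).sqrt
  have key := tendstoInDistribution_weighted_sum (μ := ν.map g)
    (integral_normalize (hν.integrable (by norm_num))) (integral_sq_normalize hσ) P
    (fun i (p : Fin (U i) × Fin (V i)) ω => g (n i p.1 p.2 ω))
    (fun i => (hn i).1.comp (fun _ => g) fun _ => hgm)
    (fun i p => (⟨hgm.aemeasurable, rfl⟩ : HasLaw g (ν.map g) ν).fun_comp ((hn i).2 p.1 p.2))
    (fun i j p => (q i j).scaledWeight p / √(∑ p, (q i j).scaledWeight p ^ 2))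
    (fun i j j' => ?_) _ hε fun i j p => Label.abs_scaledWeight_div_le (hq i j) p
  · convert key using 4 with i ω j
    rw [noiseCoeff_eq_sum, standardize_weighted_sum hν (hn i).1 fun p => (hn i).2 p.1 p.2]
  · simp only [div_mul_div_comm, ← Finset.sum_div]
    split_ifs with hj
    · subst hj
      have hS := Label.sum_scaledWeight_sq_pos (hq i j)
      rw [Real.mul_self_sqrt hS.le]
      simp only [← sq]
      exact div_self hS.ne'
    · rw [Label.sum_scaledWeight_mul_scaledWeight (hconj i j j' hj), zero_div]

end DFTNoise

theorem theorem1
    (ν : Measure ℝ) [IsProbabilityMeasure ν]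
    (hν : DFTNoise.HasFiniteCumulants ν) (hσ : 0 < variance id ν)
    (U V : ℕ → ℕ) (hUV : Tendsto (fun i => U i * V i) atTop atTop)
    {Ω : ℕ → Type*} [∀ i, MeasurableSpace (Ω i)]
    (P : ∀ i, Measure (Ω i)) [∀ i, IsProbabilityMeasure (P i)]
    (n : ∀ i, Fin (U i) → Fin (V i) → Ω i → ℝ)
    (hn : ∀ i, DFTNoise.IsIIDNoise (P i) ν (n i)) :
    -- degenerate coefficients vanish identically; all others have positive variance
    (∀ i (q : DFTNoise.Label (U i) (V i)), q.Degenerate →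
      ∀ ω, DFTNoise.noiseCoeff (n i) q ω = 0) ∧
    (∀ i (q : DFTNoise.Label (U i) (V i)), ¬ q.Degenerate →
      0 < variance (DFTNoise.noiseCoeff (n i) q) (P i)) ∧
    -- (i) each standardized coefficient converges in distribution to a standard Gaussian
    (∀ q : ∀ i, DFTNoise.Label (U i) (V i), (∀ i, ¬ (q i).Degenerate) →
      TendstoInDistribution
        (fun i => DFTNoise.standardize (P i) (DFTNoise.noiseCoeff (n i) (q i)))
        atTop (id : ℝ → ℝ) P (gaussianReal 0 1)) ∧
    -- (ii) finitely many coefficients, no two of them conjugate, are asymptotically independent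
    (∀ (d : ℕ) (q : ∀ i, Fin d → DFTNoise.Label (U i) (V i)),
      (∀ i j, ¬ (q i j).Degenerate) →
      (∀ i j j', j ≠ j' → ¬ (q i j).Conjugate (q i j')) →
      TendstoInDistribution
        (fun i ω j => DFTNoise.standardize (P i) (DFTNoise.noiseCoeff (n i) (q i j)) ω)
        atTop (id : (Fin d → ℝ) → (Fin d → ℝ)) P
        (Measure.pi fun _ : Fin d => gaussianReal 0 1)) := by
  have hLp := hν.memLp_two
  refine ⟨fun i q hq => DFTNoise.noiseCoeff_eq_zero (n i) hq,
    fun i q hq => DFTNoise.variance_noiseCoeff_pos hLp hσ (hn i) hq, fun q hq => ?_,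
    fun d q hq hconj => DFTNoise.tendstoInDistribution_standardize_noiseCoeff hLp hσ hUV hn q hq
      hconj⟩
  -- Claim (i) is the case `d = 1` of (ii), where non-conjugacy is vacuous, projected to the only
  -- coordinate.
  have h := (DFTNoise.tendstoInDistribution_standardize_noiseCoeff hLp hσ hUV hn (d := 1)
    (fun i _ => q i) (fun i _ => hq i)
    fun i j j' hj => absurd (Subsingleton.elim j j') hj).continuous_comp
      (continuous_apply (0 : Fin 1))
  -- The two limit variables live on different spaces; only their laws have to agree.
  have hlim : (gaussianReal 0 1).map id =
      (Measure.pi fun _ : Fin 1 => gaussianReal 0 1).map ((fun x => x 0) ∘ id) := by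
    rw [Measure.map_id, Function.comp_id]
    exact (measurePreserving_eval (fun _ : Fin 1 => gaussianReal 0 1) 0).map_eq.symm
  refine ⟨h.forall_aemeasurable, aemeasurable_id, ?_⟩
  have ht := h.tendsto
  simp only [← hlim] at ht
  exact ht
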